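/- Let $k$ be a commutative unital ring; all algebras are associative $k$-algebras, not necessarily unital, and all bimodules over them are $k$-modules with $k$-bilinear actions (the case $k=\mathbb Z$ is that of rings and their bimodules). A set of orthogonal local units of an algebra $\mathcal R$ is a set $E\subseteq\mathcal R$ of pairwise orthogonal idempotents such that $\mathcal R=\bigoplus_{e\in E}\mathcal R e=\bigoplus_{e\in E}e\mathcal R$. A Morita context $(\mathcal R,\mathcal R',M,M',\tau,\tau')$ consists of an $\mathcal R$-$\mathcal R'$-bimodule $M$, an $\mathcal R'$-$\mathcal R$-bimodule $M'$, an $\mathcal R$-bimodule map $\tau:M\otimes_{\mathcal R'}M'\to\mathcal R$ and an $\mathcal R'$-bimodule map $\tau':M'\otimes_{\mathcal R}M\to\mathcal R'$ such that $\tau(m_1\otimes m')\,m_2=m_1\,\tau'(m'\otimes m_2)$ and $\tau'(m_1'\otimes m)\,m_2'=m_1'\,\tau(m\otimes m_2')$ for all $m,m_1,m_2\in M$ and $m',m_1',m_2'\in M'$. For a set $X$ and a $k$-module $N$, let $\mathrm{FMat}_X(N)$ be the $k$-module of all $X\times X$-matrices over $N$ with only finitely many nonzero entries. With matrix multiplication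 $\mathrm{FMat}_X(\mathcal R)$ and $\mathrm{FMat}_X(\mathcal R')$ are algebras, and $\mathrm{FMat}_X(M)$ is an $\mathrm{FMat}_X(\mathcal R)$-$\mathrm{FMat}_X(\mathcal R')$-bimodule. **Theorem.** Let $\mathcal R$ and $\mathcal R'$ be algebras with sets of orthogonal local units $E$ and $F$ respectively, and let $X$ be an infinite set with $|X|\ge|E|$ and $|X|\ge|F|$. Let $(\mathcal R,\mathcal R',M,M',\tau,\tau')$ be a Morita context in which $M$ and $M'$ are unital on both sides, that is, $\mathcal R M=M=M\mathcal R'$ and $\mathcal R'M'=M'=M'\mathcal R$, and in which $\tau$ and $\tau'$ are surjective. Then there exist $k$-linear bijections $$\Psi:\mathrm{FMat}_X(\mathcal R)\to\mathrm{FMat}_X(M),\qquad \Psi':\mathrm{FMat}_X(\mathcal R')\to\mathrm{FMat}_X(M)$$ such that $\Psi$ (written on the right of its argument) is an isomorphism of left $\mathrm{FMat}_X(\mathcal R)$-modules, $\Psi'$ is an isomorphism of right $\mathrm{FMat}_X(\mathcal R')$-modules, and $$(A\Psi)A'=A(\Psi'A')\qquad\text{for all }A\in\mathrm{FMat}_X(\mathcal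 R),\ A'\in\mathrm{FMat}_X(\mathcal R').$$ -/

import Mathlib

open scoped TensorProduct

noncomputable section

namespace StableMorita

/-- A set `E` of pairwise orthogonal idempotents of the (not necessarily unital) algebra `R`
is a set of orthogonal local units if `R = ⨁ R e = ⨁ e R`, where `e` runs over `E`. -/
structure IsOrthogonalLocalUnits (k : Type*) {R : Type*} [CommRing k] [NonUnitalRing R]
    [Module k R] [IsScalarTower k R R] [SMulCommClass k R R] (E : Set R) : Prop where
  idempotent : ∀ e ∈ E, e * e = e
  orthogonal : ∀ e ∈ E, ∀ f ∈ E, e ≠ f → e * f = 0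
  left_sum : letI := Classical.decEq E
    DirectSum.IsInternal (fun e : E => LinearMap.range (LinearMap.mulRight k (e : R)))
  right_sum : letI := Classical.decEq E
    DirectSum.IsInternal (fun e : E => LinearMap.range (LinearMap.mulLeft k (e : R)))

/-- An `R`-`S`-bimodule structure on the `k`-module `M`, where `R` and `S` are (not necessarily
unital) `k`-algebras: `k`-bilinear associative actions of `R` on the left and of `S` on the right
which commute. -/
structure Bimodule (k R S M : Type*) [CommRing k] [NonUnitalRing R] [Module k R]
    [NonUnitalRing S] [Module k S] [AddCommGroup M] [Module k M] where
  /-- the left action `(r, m) ↦ r m` -/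
  left : R →ₗ[k] M →ₗ[k] M
  /-- the right action `(m, s) ↦ m s` -/
  right : M →ₗ[k] S →ₗ[k] M
  mul_left : ∀ (r₁ r₂ : R) (m : M), left (r₁ * r₂) m = left r₁ (left r₂ m)
  right_mul : ∀ (m : M) (s₁ s₂ : S), right m (s₁ * s₂) = right (right m s₁) s₂
  left_right : ∀ (r : R) (m : M) (s : S), right (left r m) s = left r (right m s)

/-- The bimodule `M` is unital on both sides: `R M = M` and `M S = M`. -/
structure Bimodule.IsUnital {k R S M : Type*} [CommRing k] [NonUnitalRing R] [Module k R]
    [NonUnitalRing S] [Module k S] [AddCommGroup M] [Module k M]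
    (B : Bimodule k R S M) : Prop where
  left_unital : Submodule.span k {x : M | ∃ (r : R) (m : M), x = B.left r m} = ⊤
  right_unital : Submodule.span k {x : M | ∃ (m : M) (s : S), x = B.right m s} = ⊤

/-- The relations `m s ⊗ n = m ⊗ s n` in `M ⊗[k] N`. -/
def balancedRelations {k R S T M N : Type*} [CommRing k] [NonUnitalRing R] [Module k R]
    [NonUnitalRing S] [Module k S] [NonUnitalRing T] [Module k T]
    [AddCommGroup M] [Module k M] [AddCommGroup N] [Module k N]
    (B : Bimodule k R S M) (B' : Bimodule k S T N) : Submodule k (M ⊗[k] N) :=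
  Submodule.span k
    {x | ∃ (m : M) (s : S) (n : N), x = (B.right m s) ⊗ₜ[k] n - m ⊗ₜ[k] (B'.left s n)}

/-- The tensor product `M ⊗_S N` of an `R`-`S`-bimodule and an `S`-`T`-bimodule over the
(not necessarily unital) algebra `S`. -/
abbrev BalancedTensor {k R S T M N : Type*} [CommRing k] [NonUnitalRing R] [Module k R]
    [NonUnitalRing S] [Module k S] [NonUnitalRing T] [Module k T]
    [AddCommGroup M] [Module k M] [AddCommGroup N] [Module k N]
    (B : Bimodule k R S M) (B' : Bimodule k S T N) : Type _ :=
  (M ⊗[k] N) ⧸ balancedRelations B B'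

/-- The class of `m ⊗ n` in `M ⊗_S N`. -/
def btmul {k R S T M N : Type*} [CommRing k] [NonUnitalRing R] [Module k R]
    [NonUnitalRing S] [Module k S] [NonUnitalRing T] [Module k T]
    [AddCommGroup M] [Module k M] [AddCommGroup N] [Module k N]
    (B : Bimodule k R S M) (B' : Bimodule k S T N) (m : M) (n : N) : BalancedTensor B B' :=
  (balancedRelations B B').mkQ (m ⊗ₜ[k] n)

/-- A Morita context `(R, R', M, M', τ, τ')` of (not necessarily unital) `k`-algebras.
That `τ` and `τ'` are bimodule maps is expressed on the elementary tensors, which span. -/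
structure MoritaContext (k R R' M M' : Type*) [CommRing k]
    [NonUnitalRing R] [Module k R] [NonUnitalRing R'] [Module k R']
    [AddCommGroup M] [Module k M] [AddCommGroup M'] [Module k M'] where
  /-- `M` is an `R`-`R'`-bimodule -/
  bimod : Bimodule k R R' M
  /-- `M'` is an `R'`-`R`-bimodule -/
  bimod' : Bimodule k R' R M'
  /-- `τ : M ⊗_{R'} M' → R` -/
  τ : BalancedTensor bimod bimod' →ₗ[k] R
  /-- `τ' : M' ⊗_R M → R'` -/
  τ' : BalancedTensor bimod' bimod →ₗ[k] R'
  τ_left : ∀ (r : R) (m : M) (m' : M'),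
    τ (btmul bimod bimod' (bimod.left r m) m') = r * τ (btmul bimod bimod' m m')
  τ_right : ∀ (m : M) (m' : M') (r : R),
    τ (btmul bimod bimod' m (bimod'.right m' r)) = τ (btmul bimod bimod' m m') * r
  τ'_left : ∀ (r' : R') (m' : M') (m : M),
    τ' (btmul bimod' bimod (bimod'.left r' m') m) = r' * τ' (btmul bimod' bimod m' m)
  τ'_right : ∀ (m' : M') (m : M) (r' : R'),
    τ' (btmul bimod' bimod m' (bimod.right m r')) = τ' (btmul bimod' bimod m' m) * r'
  /-- `τ(m₁ ⊗ m') m₂ = m₁ τ'(m' ⊗ m₂)` -/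
  assoc : ∀ (m₁ : M) (m' : M') (m₂ : M),
    bimod.left (τ (btmul bimod bimod' m₁ m')) m₂ = bimod.right m₁ (τ' (btmul bimod' bimod m' m₂))
  /-- `τ'(m₁' ⊗ m) m₂' = m₁' τ(m ⊗ m₂')` -/
  assoc' : ∀ (m₁' : M') (m : M) (m₂' : M'),
    bimod'.left (τ' (btmul bimod' bimod m₁' m)) m₂' =
      bimod'.right m₁' (τ (btmul bimod bimod' m m₂'))

/-- `FMat X M`: the `X × X`-matrices over `M` with only finitely many nonzero entries; the
`(i, j)` entry of `A` is `A (i, j)`. -/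
abbrev FMat (X M : Type*) [Zero M] : Type _ := X × X →₀ M

/-- In a product of two matrices with finitely many nonzero entries only finitely many entries
are nonzero. -/
theorem FMat.mul_support_finite {k X M N P : Type*} [CommRing k]
    [AddCommGroup M] [Module k M] [AddCommGroup N] [Module k N] [AddCommGroup P] [Module k P]
    (β : M →ₗ[k] N →ₗ[k] P) (A : FMat X M) (B : FMat X N) :
    (Function.support
      (fun p : X × X => ∑ᶠ l : X, β (A (p.1, l)) (B (l, p.2)))).Finite := by
  classical
  refine (((A.support.image Prod.fst) ×ˢ (B.support.image Prod.snd)).finite_toSet).subset ?_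
  rintro ⟨i, j⟩ h
  obtain ⟨l, hl⟩ : ∃ l : X, β (A (i, l)) (B (l, j)) ≠ 0 := by
    by_contra hcon
    push Not at hcon
    exact h (by simp [hcon])
  simp only [Finset.coe_product, Finset.coe_image, Set.mem_prod, Set.mem_image, Finset.mem_coe,
    Finsupp.mem_support_iff]
  refine ⟨⟨(i, l), fun h0 => hl ?_, rfl⟩, ⟨(l, j), fun h0 => hl ?_, rfl⟩⟩
  · simp [h0]
  · simp [h0]

/-- The matrix product `(A B)(i, j) = ∑ l, A(i, l) B(l, j)`, where the entries are multiplied by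
means of the bilinear map `β`.  The sum has only finitely many nonzero terms. -/
def FMat.mul {k X M N P : Type*} [CommRing k]
    [AddCommGroup M] [Module k M] [AddCommGroup N] [Module k N] [AddCommGroup P] [Module k P]
    (β : M →ₗ[k] N →ₗ[k] P) (A : FMat X M) (B : FMat X N) : FMat X P :=
  Finsupp.ofSupportFinite (fun p : X × X => ∑ᶠ l : X, β (A (p.1, l)) (B (l, p.2)))
    (FMat.mul_support_finite β A B)

theorem FMat.mul_apply {k X M N P : Type*} [CommRing k]
    [AddCommGroup M] [Module k M] [AddCommGroup N] [Module k N] [AddCommGroup P] [Module k P]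
    (β : M →ₗ[k] N →ₗ[k] P) (A : FMat X M) (B : FMat X N) (i j : X) :
    FMat.mul β A B (i, j) = ∑ᶠ l : X, β (A (i, l)) (B (l, j)) := rfl

end StableMorita

end

open scoped TensorProduct

noncomputable section

namespace StableMorita

/-! Matrix products are pairings of rows with columns. The rows of `A` lie in `R^(X)` and the
columns of `A'` in `R'^(X)`. Consider the two pairings `R × M → M` (`leftPair`) and `M × R' → M`
(`rightPair`), with `R` operating on the first factor and `R'` on the second. Suppose that their
`X`-fold direct sums are isomorphic: there are an `R`-linear `φ : R^(X) ≃ M^(X)` and an `R'`-linear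
`ψ : R'^(X) ≃ M^(X)` with `⟨φ v, w⟩ = ⟨v, ψ w⟩`. Then `Ψ` applies `φ` to each row, `Ψ'` applies `ψ`
to each column, and adjointness is the identity `(AΨ)A' = A(Ψ'A')`. Treating `φ` and `ψ` as one
morphism of dual pairs, covariant on the first factor and contravariant on the second, keeps them
adjoint through the whole construction.

The isomorphism comes from an Eilenberg swindle. Elements of `M` and `M'` give morphisms between the
two pairs in both directions. By surjectivity of `τ` each local unit is a finite sum `e = ∑ τ(m_j ⊗
m'_j)`, so that the resulting morphisms exhibit `leftPair` as a retract of a direct sum of copies of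
`rightPair` (`nonempty_retract_leftPair`); `τ'` gives the converse (`nonempty_retract_rightPair`).
Since `X` is infinite and at least as large as `E` and `F`, the `X`-fold sums are retracts of each
other and absorb countably many copies of themselves, hence are isomorphic (`Iso.ofRetracts`,
`nonempty_iso_sum`). -/

/-- A bilinear pairing `V × W → N` of `k`-modules, where `V` carries operators indexed by `R` and
`W` carries operators indexed by `S`. -/
structure DualPair (k R S N V W : Type*) [CommRing k] [AddCommGroup N] [Module k N]
    [AddCommGroup V] [Module k V] [AddCommGroup W] [Module k W] where
  left : R → V →ₗ[k] V
  right : S → W →ₗ[k] W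
  pairing : V →ₗ[k] W →ₗ[k] N

/-! ### Morphisms, isomorphisms and retracts of dual pairs -/

namespace DualPair

variable {k R S N V W V' W' V'' W'' : Type*} [CommRing k] [AddCommGroup N] [Module k N]
  [AddCommGroup V] [Module k V] [AddCommGroup W] [Module k W]
  [AddCommGroup V'] [Module k V'] [AddCommGroup W'] [Module k W']
  [AddCommGroup V''] [Module k V''] [AddCommGroup W''] [Module k W'']

/-- An adjoint pair of equivariant maps. -/
structure Hom (D : DualPair k R S N V W) (D' : DualPair k R S N V' W') where
  toV : V →ₗ[k] V'
  toW : W' →ₗ[k] W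
  map_left : ∀ r v, toV (D.left r v) = D'.left r (toV v)
  map_right : ∀ s w, toW (D'.right s w) = D.right s (toW w)
  adj : ∀ v w, D'.pairing (toV v) w = D.pairing v (toW w)

/-- An adjoint pair of equivariant isomorphisms. -/
structure Iso (D : DualPair k R S N V W) (D' : DualPair k R S N V' W') where
  toV : V ≃ₗ[k] V'
  toW : W' ≃ₗ[k] W
  map_left : ∀ r v, toV (D.left r v) = D'.left r (toV v)
  map_right : ∀ s w, toW (D'.right s w) = D.right s (toW w)
  adj : ∀ v w, D'.pairing (toV v) w = D.pairing v (toW w)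

/-- `D` is a retract of `D'`. -/
structure Retract (D : DualPair k R S N V W) (D' : DualPair k R S N V' W') where
  i : Hom D D'
  r : Hom D' D
  retractV : ∀ v, r.toV (i.toV v) = v
  retractW : ∀ w, i.toW (r.toW w) = w

variable {D : DualPair k R S N V W} {D' : DualPair k R S N V' W'}
  {D'' : DualPair k R S N V'' W''}

namespace Iso

def symm (f : Iso D D') : Iso D' D where
  toV := f.toV.symm
  toW := f.toW.symm
  map_left r v := by rw [LinearEquiv.symm_apply_eq, f.map_left, LinearEquiv.apply_symm_apply]
  map_right s w := by rw [LinearEquiv.symm_apply_eq, f.map_right, LinearEquiv.apply_symm_apply]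
  adj v w := by
    have := f.adj (f.toV.symm v) (f.toW.symm w)
    simpa using this.symm

def trans (f : Iso D D') (g : Iso D' D'') : Iso D D'' where
  toV := f.toV.trans g.toV
  toW := g.toW.trans f.toW
  map_left r v := by simp [f.map_left, g.map_left]
  map_right s w := by simp [f.map_right, g.map_right]
  adj v w := by simp [f.adj, g.adj]

def toHom (f : Iso D D') : Hom D D' where
  toV := f.toV
  toW := f.toW
  map_left := f.map_left
  map_right := f.map_right
  adj := f.adj

def toRetract (f : Iso D D') : Retract D D' where
  i := f.toHom
  r := f.symm.toHom
  retractV := f.toV.symm_apply_apply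
  retractW := f.toW.apply_symm_apply

end Iso

def Hom.comp (g : Hom D' D'') (f : Hom D D') : Hom D D'' where
  toV := g.toV ∘ₗ f.toV
  toW := f.toW ∘ₗ g.toW
  map_left r v := by simp [f.map_left, g.map_left]
  map_right s w := by simp [f.map_right, g.map_right]
  adj v w := by simp [f.adj, g.adj]

def Retract.trans (f : Retract D D') (g : Retract D' D'') : Retract D D'' where
  i := g.i.comp f.i
  r := f.r.comp g.r
  retractV v := by simp [Hom.comp, g.retractV, f.retractV]
  retractW v := by simp [Hom.comp, g.retractW, f.retractW]

/-! ### Direct sums of copies of a dual pair -/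

section Sum

variable {ι κ : Type*}

variable (ι D) in
/-- The direct sum of copies of `D` indexed by `ι`. -/
def sum : DualPair k R S N (ι →₀ V) (ι →₀ W) where
  left r := Finsupp.mapRange.linearMap (D.left r)
  right s := Finsupp.mapRange.linearMap (D.right s)
  pairing := Finsupp.lsum k fun i => (LinearMap.lcomp k N (Finsupp.lapply i)) ∘ₗ D.pairing

theorem sum_pairing_apply (v : ι →₀ V) (w : ι →₀ W) :
    (D.sum ι).pairing v w = v.sum fun i x => D.pairing x (w i) := by
  simp [sum, Finsupp.sum]

@[simp]
theorem sum_left_apply (r : R) (v : ι →₀ V) (i : ι) :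
    (D.sum ι).left r v i = D.left r (v i) := rfl

@[simp]
theorem sum_right_apply (s : S) (w : ι →₀ W) (i : ι) :
    (D.sum ι).right s w i = D.right s (w i) := rfl

@[simp]
theorem sum_pairing_single_left (i : ι) (x : V) (w : ι →₀ W) :
    (D.sum ι).pairing (Finsupp.single i x) w = D.pairing x (w i) := by
  rw [sum_pairing_apply, Finsupp.sum_single_index (by simp)]

@[simp]
theorem sum_pairing_single_right (i : ι) (v : ι →₀ V) (y : W) :
    (D.sum ι).pairing v (Finsupp.single i y) = D.pairing (v i) y := by
  classical
  induction v using Finsupp.induction_linear with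
  | zero => simp
  | add f g hf hg => simp [hf, hg]
  | single j x =>
    rw [sum_pairing_single_left, Finsupp.single_apply, Finsupp.single_apply]
    by_cases h : i = j
    · subst h; simp
    · simp [h, Ne.symm h]

/-- Both sides are linear in `v`, so adjointness of a map out of a direct sum can be tested on one
summand at a time. -/
theorem sum_adj_of_single_left (f : (ι →₀ V) →ₗ[k] V') (g : W' →ₗ[k] (ι →₀ W))
    (h : ∀ i x w, D'.pairing (f (Finsupp.single i x)) w = D.pairing x (g w i))
    (v : ι →₀ V) (w : W') : D'.pairing (f v) w = (D.sum ι).pairing v (g w) := by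
  induction v using Finsupp.induction_linear with
  | zero => simp
  | add f g hf hg => simp [hf, hg]
  | single j x => simp [h]

theorem sum_adj_of_single_right (f : V' →ₗ[k] (ι →₀ V)) (g : (ι →₀ W) →ₗ[k] W')
    (h : ∀ i v y, D.pairing (f v i) y = D'.pairing v (g (Finsupp.single i y)))
    (v : V') (w : ι →₀ W) : (D.sum ι).pairing (f v) w = D'.pairing v (g w) := by
  induction w using Finsupp.induction_linear with
  | zero => simp
  | add f g hf hg => simp [hf, hg]
  | single j x => simp [h]

variable (ι) in
def Hom.sum (f : Hom D D') : Hom (D.sum ι) (D'.sum ι) where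
  toV := Finsupp.mapRange.linearMap f.toV
  toW := Finsupp.mapRange.linearMap f.toW
  map_left r v := Finsupp.ext fun i => f.map_left r _
  map_right s w := Finsupp.ext fun i => f.map_right s _
  adj := sum_adj_of_single_left _ _ fun i x w => by simp [f.adj]

variable (ι) in
def Retract.sum (f : Retract D D') : Retract (D.sum ι) (D'.sum ι) where
  i := f.i.sum ι
  r := f.r.sum ι
  retractV _ := Finsupp.ext fun _ => f.retractV _
  retractW _ := Finsupp.ext fun _ => f.retractW _

variable (ι κ D) in
def sumSum : Iso ((D.sum κ).sum ι) (D.sum (ι × κ)) where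
  toV := (Finsupp.curryLinearEquiv k).symm
  toW := Finsupp.curryLinearEquiv k
  map_left r v := Finsupp.ext fun _ => rfl
  map_right s w := Finsupp.ext fun _ => Finsupp.ext fun _ => rfl
  adj v w := by
    induction w using Finsupp.induction_linear with
    | zero => simp only [map_zero]
    | add f g hf hg => simp only [map_add, hf, hg]
    | single p y =>
      have : Finsupp.curryLinearEquiv k (Finsupp.single p y) =
        Finsupp.single p.1 (Finsupp.single p.2 y) := Finsupp.curry_single p y
      rw [this]
      simp [Finsupp.uncurry_apply]

def sumCongr (e : ι ≃ κ) : Iso (D.sum ι) (D.sum κ) where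
  toV := Finsupp.domLCongr e
  toW := Finsupp.domLCongr e.symm
  map_left r v := Finsupp.ext fun _ => rfl
  map_right r v := Finsupp.ext fun _ => rfl
  adj v w := by
    induction v using Finsupp.induction_linear with
    | zero => simp
    | add f g hf hg => simp only [map_add, LinearMap.add_apply, hf, hg]
    | single j x => simp

theorem mapDomain_sum_left (e : ι → κ) (r : R) (v : ι →₀ V) :
    Finsupp.mapDomain e ((D.sum ι).left r v) = (D.sum κ).left r (Finsupp.mapDomain e v) := by
  induction v using Finsupp.induction_linear with
  | zero => simp
  | add f g hf hg => simp [hf, hg, Finsupp.mapDomain_add]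
  | single j x => simp [sum, Finsupp.mapDomain_single]

theorem mapDomain_sum_right (e : ι → κ) (s : S) (w : ι →₀ W) :
    Finsupp.mapDomain e ((D.sum ι).right s w) = (D.sum κ).right s (Finsupp.mapDomain e w) := by
  induction w using Finsupp.induction_linear with
  | zero => simp
  | add f g hf hg => simp [hf, hg, Finsupp.mapDomain_add]
  | single j x => simp [sum, Finsupp.mapDomain_single]

/-- Extension by zero and restriction along `e` are adjoint to each other. Because the second factor
is contravariant, extension by zero belongs to `i` on `V` but to `r` on `W`. -/
def sumEmbedding (e : ι ↪ κ) : Retract (D.sum ι) (D.sum κ) where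
  i := {
    toV := Finsupp.lmapDomain V k e
    toW := Finsupp.lcomapDomain e e.injective
    map_left := mapDomain_sum_left e
    map_right s w := Finsupp.ext fun _ => rfl
    adj := sum_adj_of_single_left _ _ fun i x w => by
      simp [Finsupp.mapDomain_single, Finsupp.lcomapDomain] }
  r := {
    toV := Finsupp.lcomapDomain e e.injective
    toW := Finsupp.lmapDomain W k e
    map_left s w := Finsupp.ext fun _ => rfl
    map_right := mapDomain_sum_right e
    adj := sum_adj_of_single_right _ _ fun i x w => by
      simp [Finsupp.mapDomain_single, Finsupp.lcomapDomain] }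
  retractV v := Finsupp.comapDomain_mapDomain _ e.injective v
  retractW w := Finsupp.comapDomain_mapDomain _ e.injective w

/-- A locally finite family of maps, as a map into the direct sum. -/
def finsuppOfFinite (f : ι → V →ₗ[k] V') (h : ∀ v, (Function.support fun i => f i v).Finite) :
    V →ₗ[k] (ι →₀ V') where
  toFun v := Finsupp.ofSupportFinite (fun i => f i v) (h v)
  map_add' v w := Finsupp.ext fun i => (f i).map_add v w
  map_smul' c v := Finsupp.ext fun i => (f i).map_smul c v

@[simp]
theorem finsuppOfFinite_apply (f : ι → V →ₗ[k] V')
    (h : ∀ v, (Function.support fun i => f i v).Finite) (v : V) (i : ι) :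
    finsuppOfFinite f h v i = f i v := rfl

theorem lsum_finsuppOfFinite (f : ι → V →ₗ[k] V') (g : ι → V' →ₗ[k] V'')
    (h : ∀ v, (Function.support fun i => f i v).Finite) (v : V) (T : Finset ι)
    (hT : ∀ i ∉ T, f i v = 0) :
    Finsupp.lsum k g (finsuppOfFinite f h v) = ∑ i ∈ T, g i (f i v) := by
  rw [Finsupp.lsum_apply, Finsupp.sum_of_support_subset _ (s := T)]
  · rfl
  · intro i hi
    by_contra hc
    exact (Finsupp.mem_support_iff.mp hi) (hT i hc)
  · simp

/-- Locally finite families of maps `i j : D → D'` and `r j : D' → D` such that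
`∑ j, r j ∘ i j = id` make `D` a retract of a direct sum of copies of `D'`. -/
def retractOfFamily (i : ι → Hom D D') (r : ι → Hom D' D)
    (hV : ∀ v, ∃ T : Finset ι, (∀ j ∉ T, (i j).toV v = 0) ∧ ∑ j ∈ T, (r j).toV ((i j).toV v) = v)
    (hW : ∀ w, ∃ T : Finset ι, (∀ j ∉ T, (r j).toW w = 0) ∧
      ∑ j ∈ T, (i j).toW ((r j).toW w) = w) : Retract D (D'.sum ι) :=
  have fV : ∀ v, (Function.support fun j => (i j).toV v).Finite := fun v => by
    obtain ⟨T, hT, -⟩ := hV v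
    exact T.finite_toSet.subset fun j hj => by_contra fun hc => hj (hT j hc)
  have fW : ∀ w, (Function.support fun j => (r j).toW w).Finite := fun w => by
    obtain ⟨T, hT, -⟩ := hW w
    exact T.finite_toSet.subset fun j hj => by_contra fun hc => hj (hT j hc)
  { i := {
      -- Local finiteness is needed only for the maps into the direct sum, which are `i` on `V` and
      -- `r` on `W`; the maps out of it are sums over finite supports.
      toV := finsuppOfFinite (fun j => (i j).toV) fV
      toW := Finsupp.lsum k fun j => (i j).toW
      map_left := fun a v => Finsupp.ext fun j => (i j).map_left a v
      map_right := fun a w => by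
        induction w using Finsupp.induction_linear with
        | zero => simp
        | add f g hf hg => simp only [map_add, hf, hg]
        | single j x => simp [sum, (i j).map_right]
      adj := sum_adj_of_single_right _ _ fun j v y => by
        simpa using (i j).adj v y }
    r := {
      toV := Finsupp.lsum k fun j => (r j).toV
      toW := finsuppOfFinite (fun j => (r j).toW) fW
      map_left := fun a w => by
        induction w using Finsupp.induction_linear with
        | zero => simp
        | add f g hf hg => simp only [map_add, hf, hg]
        | single j x => simp [sum, (r j).map_left]
      map_right := fun a v => Finsupp.ext fun j => (r j).map_right a v
      adj := sum_adj_of_single_left _ _ fun j v y => by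
        simpa using (r j).adj v y }
    retractV := fun v => by
      obtain ⟨T, hT, h⟩ := hV v
      exact (lsum_finsuppOfFinite _ _ fV v T hT).trans h
    retractW := fun w => by
      obtain ⟨T, hT, h⟩ := hW w
      exact (lsum_finsuppOfFinite _ _ fW w T hT).trans h }

end Sum

end DualPair


/-! ### The Eilenberg swindle for dual pairs -/

namespace DualPair

variable {k R S N V W V' W' V'' W'' U : Type*} [CommRing k] [AddCommGroup N] [Module k N]
  [AddCommGroup V] [Module k V] [AddCommGroup W] [Module k W]
  [AddCommGroup V'] [Module k V'] [AddCommGroup W'] [Module k W']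
  [AddCommGroup V''] [Module k V''] [AddCommGroup W''] [Module k W'']
  [AddCommGroup U] [Module k U]

/-- The direct sum of two dual pairs. -/
def prod (D : DualPair k R S N V W) (D' : DualPair k R S N V' W') :
    DualPair k R S N (V × V') (W × W') where
  left r := (D.left r).prodMap (D'.left r)
  right s := (D.right s).prodMap (D'.right s)
  pairing := D.pairing.compl₁₂ (LinearMap.fst k V V') (LinearMap.fst k W W') +
    D'.pairing.compl₁₂ (LinearMap.snd k V V') (LinearMap.snd k W W')

variable {D : DualPair k R S N V W} {D' : DualPair k R S N V' W'}
  {D'' : DualPair k R S N V'' W''}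

variable (D D') in
def prodComm : Iso (D.prod D') (D'.prod D) where
  toV := LinearEquiv.prodComm k V V'
  toW := LinearEquiv.prodComm k W' W
  map_left _ _ := rfl
  map_right _ _ := rfl
  adj _ _ := add_comm _ _

variable (D) in
def Iso.prodLeft (f : Iso D' D'') : Iso (D.prod D') (D.prod D'') where
  toV := (LinearEquiv.refl k V).prodCongr f.toV
  toW := (LinearEquiv.refl k W).prodCongr f.toW
  map_left r v := Prod.ext rfl (f.map_left r v.2)
  map_right s w := Prod.ext rfl (f.map_right s w.2)
  adj v w := congrArg (D.pairing v.1 w.1 + ·) (f.adj v.2 w.2)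

/-- The head of a finitely supported sequence. -/
def seqHead : (ℕ →₀ V) →ₗ[k] V := Finsupp.lapply 0

/-- The tail of a finitely supported sequence. -/
def seqTail : (ℕ →₀ V) →ₗ[k] (ℕ →₀ V) := Finsupp.lcomapDomain Nat.succ Nat.succ_injective

/-- Prepend an entry to a finitely supported sequence. -/
def seqCons : V × (ℕ →₀ V) →ₗ[k] (ℕ →₀ V) :=
  (Finsupp.lsingle 0).coprod (Finsupp.lmapDomain V k Nat.succ)

@[simp]
theorem seqHead_apply (q : ℕ →₀ V) : seqHead (k := k) q = q 0 := rfl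

@[simp]
theorem seqTail_apply (q : ℕ →₀ V) (n : ℕ) : seqTail (k := k) q n = q (n + 1) := rfl

@[simp]
theorem seqCons_zero (x : V × (ℕ →₀ V)) : seqCons (k := k) x 0 = x.1 := by
  have : Finsupp.mapDomain Nat.succ x.2 0 = 0 :=
    Finsupp.mapDomain_of_notMem_range _ _ (by simp)
  simp [seqCons, this]

@[simp]
theorem seqCons_succ (x : V × (ℕ →₀ V)) (n : ℕ) : seqCons (k := k) x (n + 1) = x.2 n := by
  have : Finsupp.mapDomain Nat.succ x.2 (Nat.succ n) = x.2 n :=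
    Finsupp.mapDomain_apply Nat.succ_injective _ _
  simp [seqCons, this]

/-- The forward map of the Eilenberg swindle:
`(q₀, q₁, …) ↦ (b q₀, (e q₁ + (1 - e) q₀, e q₂ + (1 - e) q₁, …))` with `e = a b`. -/
def swindleFun (a : U →ₗ[k] V) (b : V →ₗ[k] U) : (ℕ →₀ V) →ₗ[k] U × (ℕ →₀ V) :=
  (b ∘ₗ seqHead).prod
    (Finsupp.mapRange.linearMap (a ∘ₗ b) ∘ₗ seqTail +
      Finsupp.mapRange.linearMap (LinearMap.id - a ∘ₗ b))

/-- The backward map of the Eilenberg swindle. -/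
def swindleInv (a : U →ₗ[k] V) (b : V →ₗ[k] U) : U × (ℕ →₀ V) →ₗ[k] (ℕ →₀ V) :=
  seqCons ∘ₗ a.prodMap (Finsupp.mapRange.linearMap (a ∘ₗ b)) +
    Finsupp.mapRange.linearMap (LinearMap.id - a ∘ₗ b) ∘ₗ LinearMap.snd k U (ℕ →₀ V)

@[simp]
theorem swindleFun_fst (a : U →ₗ[k] V) (b : V →ₗ[k] U) (q : ℕ →₀ V) :
    (swindleFun a b q).1 = b (q 0) := rfl

@[simp]
theorem swindleFun_snd (a : U →ₗ[k] V) (b : V →ₗ[k] U) (q : ℕ →₀ V) (n : ℕ) :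
    (swindleFun a b q).2 n = a (b (q (n + 1))) + (q n - a (b (q n))) := rfl

@[simp]
theorem swindleInv_zero (a : U →ₗ[k] V) (b : V →ₗ[k] U) (x : U × (ℕ →₀ V)) :
    swindleInv a b x 0 = a x.1 + (x.2 0 - a (b (x.2 0))) := by
  simp [swindleInv]

@[simp]
theorem swindleInv_succ (a : U →ₗ[k] V) (b : V →ₗ[k] U) (x : U × (ℕ →₀ V)) (n : ℕ) :
    swindleInv a b x (n + 1) = a (b (x.2 n)) + (x.2 (n + 1) - a (b (x.2 (n + 1)))) := by
  simp [swindleInv]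

theorem swindleFun_single_zero (a : U →ₗ[k] V) (b : V →ₗ[k] U) (y : V) :
    swindleFun a b (Finsupp.single 0 y) = (b y, Finsupp.single 0 (y - a (b y))) := by
  refine Prod.ext (by simp) (Finsupp.ext fun n => ?_)
  cases n <;> simp

theorem swindleFun_single_succ (a : U →ₗ[k] V) (b : V →ₗ[k] U) (n : ℕ) (y : V) :
    swindleFun a b (Finsupp.single (n + 1) y) =
      (0, Finsupp.single n (a (b y)) + Finsupp.single (n + 1) (y - a (b y))) := by
  classical
  refine Prod.ext (by simp) (Finsupp.ext fun m => ?_)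
  simp only [swindleFun_snd, Finsupp.single_apply, Finsupp.add_apply, add_left_inj]
  split_ifs <;> simp

/-- As `b a = 1`, `e = a b` is idempotent. The components in the image of `e` are shifted by one
place, the first of them becoming the entry in `U`, while the complementary components stay in
place. The backward map undoes the shift, and no complement of `U` has to be chosen. -/
def swindleEquiv (a : U →ₗ[k] V) (b : V →ₗ[k] U) (h : ∀ u, b (a u) = u) :
    (ℕ →₀ V) ≃ₗ[k] U × (ℕ →₀ V) where
  __ := swindleFun a b
  invFun := swindleInv a b
  left_inv q := by
    ext n
    cases n <;> simp [h]
  right_inv x := by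
    refine Prod.ext ?_ (Finsupp.ext fun n => ?_)
    · simp [h]
    · cases n <;> simp [h]

/-- Eilenberg swindle: a retract of `D'` is absorbed by countably many copies of `D'`. -/
def Retract.swindle (f : Retract D D') : Iso (D'.sum ℕ) (D.prod (D'.sum ℕ)) where
  toV := swindleEquiv f.i.toV f.r.toV f.retractV
  -- Transposition exchanges the two swindle maps: the adjoint of the forward map for `(i, r)` on
  -- `V` is the backward map for `(r, i)` on `W`.
  toW := (swindleEquiv f.r.toW f.i.toW f.retractW).symm
  map_left r q := by
    refine Prod.ext (f.r.map_left r _) (Finsupp.ext fun n => ?_)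
    change f.i.toV (f.r.toV (D'.left r (q (n + 1)))) +
      (D'.left r (q n) - f.i.toV (f.r.toV (D'.left r (q n)))) =
      D'.left r (f.i.toV (f.r.toV (q (n + 1))) + (q n - f.i.toV (f.r.toV (q n))))
    simp [f.r.map_left, f.i.map_left]
  map_right s x := by
    refine Finsupp.ext fun n => ?_
    change swindleInv f.r.toW f.i.toW (D.right s x.1, (D'.sum ℕ).right s x.2) n =
      D'.right s (swindleInv f.r.toW f.i.toW x n)
    cases n <;> simp [f.r.map_right, f.i.map_right]
  adj q x := by
    change D.pairing (swindleFun f.i.toV f.r.toV q).1 x.1 +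
      (D'.sum ℕ).pairing (swindleFun f.i.toV f.r.toV q).2 x.2 =
      (D'.sum ℕ).pairing q (swindleInv f.r.toW f.i.toW x)
    induction q using Finsupp.induction_linear with
    | zero => simp
    | add p q hp hq =>
      simp only [map_add, LinearMap.add_apply, Prod.fst_add, Prod.snd_add, ← hp, ← hq]
      abel
    | single n y =>
      cases n with
      | zero =>
        rw [swindleFun_single_zero]
        simp [f.r.adj, f.i.adj]
      | succ n =>
        rw [swindleFun_single_succ]
        simp [f.r.adj, f.i.adj]

/-- Dual pairs which absorb countably many copies of themselves and are retracts of each other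
are isomorphic. -/
def Iso.ofRetracts (f : Retract D D') (g : Retract D' D) (h : Iso (D.sum ℕ) D)
    (h' : Iso (D'.sum ℕ) D') : Iso D D' :=
  -- The chain is `D ≅ D^(ℕ) ≅ D' ⊕ D^(ℕ) ≅ D' ⊕ D ≅ D ⊕ D' ≅ D ⊕ D'^(ℕ) ≅ D'^(ℕ) ≅ D'`.
  (h.symm.trans (g.swindle.trans (h.prodLeft D'))).trans <|
    (prodComm D' D).trans (h'.symm.trans (f.swindle.trans (h'.prodLeft D))).symm

end DualPair


/-! ### Decomposition of algebras and unital bimodules by local units -/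

section LocalUnits

variable {k V J : Type*} [CommRing k] [AddCommGroup V] [Module k V]

/-- Orthogonal projections whose ranges span are locally finite and add up to the identity. -/
theorem exists_finset_sum_eq_of_iSup_range_eq_top (p : J → V →ₗ[k] V)
    (hp : ∀ j v, p j (p j v) = p j v) (ho : ∀ i j, i ≠ j → ∀ v, p i (p j v) = 0)
    (h : ⨆ j, LinearMap.range (p j) = ⊤) (v : V) :
    ∃ T : Finset J, (∀ j ∉ T, p j v = 0) ∧ ∑ j ∈ T, p j v = v := by
  classical
  have hv : v ∈ ⨆ j, LinearMap.range (p j) := h ▸ Submodule.mem_top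
  obtain ⟨f, hf, rfl⟩ := (Submodule.mem_iSup_iff_exists_finsupp _ _).mp hv
  -- In a finite decomposition of the vector with components in the ranges, `p j` fixes the `j`-th
  -- component and kills the others.
  have key : ∀ j, p j (f.sum fun _ x => x) = f j := fun j => by
    rw [Finsupp.sum, map_sum]
    have : ∀ i ∈ f.support, p j (f i) = if i = j then f i else 0 := fun i _ => by
      obtain ⟨x, hx⟩ := hf i
      rw [← hx]
      split_ifs with hij
      · subst hij; exact hp _ _
      · exact ho _ _ (Ne.symm hij) _
    rw [Finset.sum_congr rfl this, Finset.sum_ite_eq']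
    split_ifs with hj
    · rfl
    · exact (Finsupp.notMem_support_iff.mp hj).symm
  refine ⟨f.support, fun j hj => ?_, ?_⟩
  · rw [key]; exact Finsupp.notMem_support_iff.mp hj
  · exact Finset.sum_congr rfl fun j _ => key j

variable {R S M : Type*} [NonUnitalRing R] [Module k R] [NonUnitalRing S] [Module k S]
  [AddCommGroup M] [Module k M]

theorem IsOrthogonalLocalUnits.sum_mul_right [IsScalarTower k R R]
    [SMulCommClass k R R] {E : Set R}
    (hE : IsOrthogonalLocalUnits k E) (r : R) :
    ∃ T : Finset E, (∀ e ∉ T, r * e = 0) ∧ ∑ e ∈ T, r * (e : R) = r :=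
  exists_finset_sum_eq_of_iSup_range_eq_top (fun e : E => LinearMap.mulRight k (e : R))
    (fun e v => by simp [mul_assoc, hE.idempotent e e.2])
    (fun e f hef v => by
      simp [mul_assoc, hE.orthogonal f f.2 e e.2 fun h => hef (Subtype.ext h.symm)])
    (@DirectSum.IsInternal.submodule_iSup_eq_top _ _ _ (_) _ _ _ _ hE.left_sum) r

theorem IsOrthogonalLocalUnits.sum_mul_left [IsScalarTower k R R]
    [SMulCommClass k R R] {E : Set R}
    (hE : IsOrthogonalLocalUnits k E) (r : R) :
    ∃ T : Finset E, (∀ e ∉ T, e * r = 0) ∧ ∑ e ∈ T, (e : R) * r = r :=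
  exists_finset_sum_eq_of_iSup_range_eq_top (fun e : E => LinearMap.mulLeft k (e : R))
    (fun e v => by simp [← mul_assoc, hE.idempotent e e.2])
    (fun e f hef v => by
      simp [← mul_assoc, hE.orthogonal e e.2 f f.2 fun h => hef (Subtype.ext h)])
    (@DirectSum.IsInternal.submodule_iSup_eq_top _ _ _ (_) _ _ _ _ hE.right_sum) r

/-- Unitality reduces the spanning condition to elements `r m`, and there the decomposition `r = ∑ e
r` in the algebra applies. -/
theorem IsOrthogonalLocalUnits.sum_left [IsScalarTower k R R]
    [SMulCommClass k R R] {E : Set R} (hE : IsOrthogonalLocalUnits k E)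
    {B : Bimodule k R S M} (hB : B.IsUnital) (m : M) :
    ∃ T : Finset E, (∀ e ∉ T, B.left e m = 0) ∧ ∑ e ∈ T, B.left (e : R) m = m := by
  refine exists_finset_sum_eq_of_iSup_range_eq_top (fun e : E => B.left (e : R))
    (fun e v => by rw [← B.mul_left, hE.idempotent e e.2])
    (fun e f hef v => by
      rw [← B.mul_left, hE.orthogonal e e.2 f f.2 fun h => hef (Subtype.ext h), map_zero,
        LinearMap.zero_apply]) ?_ m
  rw [eq_top_iff, ← hB.left_unital, Submodule.span_le]
  rintro _ ⟨r, m, rfl⟩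
  obtain ⟨T, -, hT⟩ := hE.sum_mul_left r
  rw [← hT, map_sum, LinearMap.sum_apply]
  refine Submodule.sum_mem _ fun e _ => Submodule.mem_iSup_of_mem e ?_
  rw [B.mul_left]
  exact LinearMap.mem_range_self _ _

theorem IsOrthogonalLocalUnits.sum_right [IsScalarTower k S S]
    [SMulCommClass k S S] {F : Set S} (hF : IsOrthogonalLocalUnits k F)
    {B : Bimodule k R S M} (hB : B.IsUnital) (m : M) :
    ∃ T : Finset F, (∀ f ∉ T, B.right m f = 0) ∧ ∑ f ∈ T, B.right m (f : S) = m := by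
  refine exists_finset_sum_eq_of_iSup_range_eq_top (fun f : F => B.right.flip (f : S))
    (fun e v => by simp only [LinearMap.flip_apply, ← B.right_mul, hF.idempotent e e.2])
    (fun e f hef v => by
      simp only [LinearMap.flip_apply, ← B.right_mul,
        hF.orthogonal f f.2 e e.2 fun h => hef (Subtype.ext h.symm), map_zero]) ?_ m
  rw [eq_top_iff, ← hB.right_unital, Submodule.span_le]
  rintro _ ⟨m, s, rfl⟩
  obtain ⟨T, -, hT⟩ := hF.sum_mul_right s
  rw [← hT, map_sum]
  refine Submodule.sum_mem _ fun f _ => Submodule.mem_iSup_of_mem f ?_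
  rw [B.right_mul]
  exact LinearMap.mem_range_self (B.right.flip (f : S)) _

end LocalUnits

/-! ### Morita contexts and the retractions they induce -/

theorem exists_fin_sum_btmul {k R S T M N : Type*} [CommRing k] [NonUnitalRing R] [Module k R]
    [NonUnitalRing S] [Module k S] [NonUnitalRing T] [Module k T]
    [AddCommGroup M] [Module k M] [AddCommGroup N] [Module k N]
    (B : Bimodule k R S M) (B' : Bimodule k S T N) (t : BalancedTensor B B') :
    ∃ (n : ℕ) (m : Fin n → M) (m' : Fin n → N), t = ∑ j, btmul B B' (m j) (m' j) := by
  obtain ⟨x, rfl⟩ := (balancedRelations B B').mkQ_surjective t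
  obtain ⟨s, rfl⟩ := TensorProduct.exists_finset x
  refine ⟨s.card, fun j => (s.equivFin.symm j).1.1, fun j => (s.equivFin.symm j).1.2, ?_⟩
  rw [map_sum, s.equivFin.symm.sum_comp fun p : s => btmul B B' p.1.1 p.1.2,
    Finset.sum_coe_sort s fun p => btmul B B' p.1 p.2]
  rfl

theorem btmul_balanced {k R S T M N : Type*} [CommRing k] [NonUnitalRing R] [Module k R]
    [NonUnitalRing S] [Module k S] [NonUnitalRing T] [Module k T]
    [AddCommGroup M] [Module k M] [AddCommGroup N] [Module k N]
    (B : Bimodule k R S M) (B' : Bimodule k S T N) (m : M) (s : S) (n : N) :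
    btmul B B' (B.right m s) n = btmul B B' m (B'.left s n) := by
  rw [btmul, btmul, ← sub_eq_zero, ← map_sub, Submodule.mkQ_apply, Submodule.Quotient.mk_eq_zero]
  exact Submodule.subset_span ⟨m, s, n, rfl⟩

namespace MoritaContext

variable {k R R' M M' : Type*} [CommRing k]
  [NonUnitalRing R] [Module k R] [NonUnitalRing R'] [Module k R']
  [AddCommGroup M] [Module k M] [AddCommGroup M'] [Module k M']

/-- `τ` as a bilinear map. -/
def τPair (C : MoritaContext k R R' M M') : M →ₗ[k] M' →ₗ[k] R :=
  TensorProduct.curry (C.τ ∘ₗ (balancedRelations C.bimod C.bimod').mkQ)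

/-- `τ'` as a bilinear map. -/
def τPair' (C : MoritaContext k R R' M M') : M' →ₗ[k] M →ₗ[k] R' :=
  TensorProduct.curry (C.τ' ∘ₗ (balancedRelations C.bimod' C.bimod).mkQ)

variable (C : MoritaContext k R R' M M')

theorem τPair_left (r : R) (m : M) (m' : M') :
    C.τPair (C.bimod.left r m) m' = r * C.τPair m m' := C.τ_left r m m'

theorem τPair_right (m : M) (m' : M') (r : R) :
    C.τPair m (C.bimod'.right m' r) = C.τPair m m' * r := C.τ_right m m' r

theorem τPair'_left (r : R') (m' : M') (m : M) :
    C.τPair' (C.bimod'.left r m') m = r * C.τPair' m' m := C.τ'_left r m' m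

theorem τPair'_right (m' : M') (m : M) (r : R') :
    C.τPair' m' (C.bimod.right m r) = C.τPair' m' m * r := C.τ'_right m' m r

theorem τPair_balanced (m : M) (r : R') (m' : M') :
    C.τPair (C.bimod.right m r) m' = C.τPair m (C.bimod'.left r m') :=
  congrArg C.τ (btmul_balanced _ _ m r m')

theorem τPair'_balanced (m' : M') (r : R) (m : M) :
    C.τPair' (C.bimod'.right m' r) m = C.τPair' m' (C.bimod.left r m) :=
  congrArg C.τ' (btmul_balanced _ _ m' r m)

theorem τPair_assoc (m₁ : M) (m' : M') (m₂ : M) :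
    C.bimod.left (C.τPair m₁ m') m₂ = C.bimod.right m₁ (C.τPair' m' m₂) := C.assoc m₁ m' m₂

theorem exists_fin_sum_τPair (h : Function.Surjective C.τ) (r : R) :
    ∃ (n : ℕ) (m : Fin n → M) (m' : Fin n → M'), r = ∑ j, C.τPair (m j) (m' j) := by
  obtain ⟨t, rfl⟩ := h r
  obtain ⟨n, m, m', rfl⟩ := exists_fin_sum_btmul _ _ t
  exact ⟨n, m, m', map_sum _ _ _⟩

theorem exists_fin_sum_τPair' (h : Function.Surjective C.τ') (r : R') :
    ∃ (n : ℕ) (m : Fin n → M) (m' : Fin n → M'), r = ∑ j, C.τPair' (m' j) (m j) := by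
  obtain ⟨t, rfl⟩ := h r
  obtain ⟨n, m', m, rfl⟩ := exists_fin_sum_btmul _ _ t
  exact ⟨n, m, m', map_sum _ _ _⟩

variable [SMulCommClass k R R] [IsScalarTower k R' R']

/-- The dual pair `R × M → M`. -/
def leftPair : DualPair k R R' M R M where
  left r := LinearMap.mulLeft k r
  right s := C.bimod.right.flip s
  pairing := C.bimod.left

/-- The dual pair `M × R' → M`. -/
def rightPair : DualPair k R R' M M R' where
  left r := C.bimod.left r
  right s := LinearMap.mulRight k s
  pairing := C.bimod.right

/-- Multiplication by `m : M`. -/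
def homOfLeft (m : M) : DualPair.Hom C.leftPair C.rightPair where
  toV := C.bimod.left.flip m
  toW := C.bimod.right m
  map_left r v := C.bimod.mul_left r v m
  map_right s w := C.bimod.right_mul m w s
  adj v w := C.bimod.left_right v m w

/-- Multiplication by `m' : M'`. -/
def homOfRight (m' : M') : DualPair.Hom C.rightPair C.leftPair where
  toV := C.τPair.flip m'
  toW := C.τPair' m'
  map_left r v := C.τPair_left r v m'
  map_right s w := C.τPair'_right m' w s
  -- Adjointness is exactly the Morita identity `τ(v ⊗ m') w = v τ'(m' ⊗ w)`.
  adj v w := C.τPair_assoc v m' w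

/-- With `e = ∑ τ(m_j ⊗ m'_j)`, the composites for a fixed `e` add up to `r ↦ r e` on `R` and, by
the Morita identity, to `y ↦ e y` on `M`. Summing over `e` gives the identity on both factors. -/
theorem nonempty_retract_leftPair [IsScalarTower k R R] {E : Set R}
    (hE : IsOrthogonalLocalUnits k E)
    (hM : C.bimod.IsUnital) (hτ : Function.Surjective C.τ) :
    ∃ n : E → ℕ, Nonempty (DualPair.Retract C.leftPair (C.rightPair.sum (Σ e, Fin (n e)))) := by
  choose n m m' h using fun e : E => C.exists_fin_sum_τPair hτ (e : R)
  have he (e : E) : (e : R) * e = e := hE.idempotent e e.2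
  refine ⟨n, ⟨DualPair.retractOfFamily
    -- Replacing `m_j`, `m'_j` by `e m_j`, `m'_j e` makes the families locally finite: they vanish
    -- on `r` when `r e = 0`, and on `y` when `e y = 0`. The sum over `j` becomes `e e e = e`.
    (fun p => C.homOfLeft (C.bimod.left p.1 (m p.1 p.2)))
    (fun p => C.homOfRight (C.bimod'.right (m' p.1 p.2) p.1)) (fun r => ?_) (fun y => ?_)⟩⟩
  · obtain ⟨T, hT, hs⟩ := hE.sum_mul_right r
    refine ⟨T.sigma fun _ => Finset.univ, fun p hp => ?_, ?_⟩
    · change C.bimod.left r (C.bimod.left p.1 _) = 0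
      rw [← C.bimod.mul_left, hT p.1 (by simpa using hp), map_zero, LinearMap.zero_apply]
    · rw [Finset.sum_sigma]
      refine (Finset.sum_congr rfl fun e _ => ?_).trans hs
      change ∑ j, C.τPair (C.bimod.left r (C.bimod.left e (m e j)))
        (C.bimod'.right (m' e j) e) = r * e
      simp only [τPair_left, τPair_right, ← Finset.mul_sum, ← Finset.sum_mul, ← h, he, mul_assoc]
  · obtain ⟨T, hT, hs⟩ := hE.sum_left hM y
    refine ⟨T.sigma fun _ => Finset.univ, fun p hp => ?_, ?_⟩
    · change C.τPair' (C.bimod'.right _ p.1) y = 0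
      rw [τPair'_balanced, hT p.1 (by simpa using hp), map_zero]
    · rw [Finset.sum_sigma]
      refine (Finset.sum_congr rfl fun e _ => ?_).trans hs
      change ∑ j, C.bimod.right (C.bimod.left e (m e j))
        (C.τPair' (C.bimod'.right (m' e j) e) y) = C.bimod.left e y
      simp only [← τPair_assoc, τPair_left, τPair_right, ← LinearMap.sum_apply, ← map_sum,
        ← Finset.mul_sum, ← Finset.sum_mul, ← h, he]

/-- The mirror image: writing `f = ∑ τ'(m'_j ⊗ m_j)`, the composites for a fixed `f` add up to `y ↦
y f` on `M` and `r ↦ f r` on `R'`. -/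
theorem nonempty_retract_rightPair [SMulCommClass k R' R'] {F : Set R'}
    (hF : IsOrthogonalLocalUnits k F)
    (hM : C.bimod.IsUnital) (hτ' : Function.Surjective C.τ') :
    ∃ n : F → ℕ, Nonempty (DualPair.Retract C.rightPair (C.leftPair.sum (Σ f, Fin (n f)))) := by
  choose n m m' h using fun f : F => C.exists_fin_sum_τPair' hτ' (f : R')
  have hf (f : F) : (f : R') * f = f := hF.idempotent f f.2
  refine ⟨n, ⟨DualPair.retractOfFamily
    (fun p => C.homOfRight (C.bimod'.left p.1 (m' p.1 p.2)))
    (fun p => C.homOfLeft (C.bimod.right (m p.1 p.2) p.1)) (fun y => ?_) (fun r => ?_)⟩⟩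
  · obtain ⟨T, hT, hs⟩ := hF.sum_right hM y
    refine ⟨T.sigma fun _ => Finset.univ, fun p hp => ?_, ?_⟩
    · change C.τPair y (C.bimod'.left p.1 _) = 0
      rw [← τPair_balanced, hT p.1 (by simpa using hp), map_zero, LinearMap.zero_apply]
    · rw [Finset.sum_sigma]
      refine (Finset.sum_congr rfl fun f _ => ?_).trans hs
      change ∑ j, C.bimod.left (C.τPair y (C.bimod'.left f (m' f j)))
        (C.bimod.right (m f j) f) = C.bimod.right y f
      simp only [τPair_assoc, τPair'_left, τPair'_right, ← map_sum,
        ← Finset.mul_sum, ← Finset.sum_mul, ← h, hf]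
  · obtain ⟨T, hT, hs⟩ := hF.sum_mul_left r
    refine ⟨T.sigma fun _ => Finset.univ, fun p hp => ?_, ?_⟩
    · change C.bimod.right (C.bimod.right _ p.1) r = 0
      rw [← C.bimod.right_mul, hT p.1 (by simpa using hp), map_zero]
    · rw [Finset.sum_sigma]
      refine (Finset.sum_congr rfl fun f _ => ?_).trans hs
      change ∑ j, C.τPair' (C.bimod'.left f (m' f j))
        (C.bimod.right (C.bimod.right (m f j) f) r) = f * r
      simp only [τPair'_left, τPair'_right, ← Finset.mul_sum, ← Finset.sum_mul, ← h, hf]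

end MoritaContext

/-! ### Absorption in direct sums over an infinite index set -/

/-- The finite fibres embed in a countable subset of `X`, so the disjoint union embeds in `X × X`,
and `X × X ≃ X` for infinite `X`. -/
theorem nonempty_prod_sigma_fin_embedding {X J : Type*} [Infinite X] (h : Nonempty (J ↪ X))
    (n : J → ℕ) : Nonempty (X × (Σ j, Fin (n j)) ↪ X) := by
  obtain ⟨f⟩ := h
  have hXX : Nonempty (X × X ≃ X) := Cardinal.eq.mp (by simp)
  obtain ⟨e⟩ := hXX
  let g : (Σ j, Fin (n j)) ↪ X × X :=
    ⟨fun p => (f p.1, Infinite.natEmbedding X p.2), by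
      rintro ⟨a, i⟩ ⟨b, j⟩ h
      obtain ⟨h₁, h₂⟩ := Prod.mk.inj h
      obtain rfl := f.injective h₁
      obtain rfl := Fin.ext ((Infinite.natEmbedding X).injective h₂)
      rfl⟩
  exact ⟨((Function.Embedding.refl X).prodMap (g.trans e.toEmbedding)).trans e.toEmbedding⟩

namespace DualPair

variable {k R S N V W V' W' X : Type*} [CommRing k] [AddCommGroup N] [Module k N]
  [AddCommGroup V] [Module k V] [AddCommGroup W] [Module k W]
  [AddCommGroup V'] [Module k V'] [AddCommGroup W'] [Module k W']
  {D : DualPair k R S N V W} {D' : DualPair k R S N V' W'}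

/-- An infinite direct sum absorbs countably many copies of itself. -/
theorem nonempty_sum_nat_iso (D : DualPair k R S N V W) (X : Type*) [Infinite X] :
    Nonempty (Iso ((D.sum X).sum ℕ) (D.sum X)) := by
  have h : Nonempty (ℕ × X ≃ X) := by
    refine Cardinal.eq.mp ?_
    rw [Cardinal.mk_prod]
    simp
  obtain ⟨e⟩ := h
  exact ⟨(sumSum D ℕ X).trans (sumCongr e)⟩

/-- Taking `X`-fold sums turns the retractions into retractions onto `X × J`-fold and `X × J'`-fold
sums, which are themselves retracts of `X`-fold sums; the swindle then applies. -/
theorem nonempty_iso_sum {J J' X : Type*} [Infinite X] (f : Retract D (D'.sum J))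
    (g : Retract D' (D.sum J')) (h : Nonempty (X × J ↪ X)) (h' : Nonempty (X × J' ↪ X)) :
    Nonempty (Iso (D.sum X) (D'.sum X)) := by
  obtain ⟨a⟩ := D.nonempty_sum_nat_iso X
  obtain ⟨a'⟩ := D'.nonempty_sum_nat_iso X
  obtain ⟨e⟩ := h
  obtain ⟨e'⟩ := h'
  exact ⟨.ofRetracts
    (((f.sum X).trans (sumSum D' X J).toRetract).trans (sumEmbedding e))
    (((g.sum X).trans (sumSum D X J').toRetract).trans (sumEmbedding e')) a a'⟩

end DualPair

/-! ### Matrices as families of rows and of columns -/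

section Matrices

variable {k X V W N : Type*} [CommRing k] [AddCommGroup V] [Module k V]
  [AddCommGroup W] [Module k W] [AddCommGroup N] [Module k N]

theorem FMat.mul_apply_eq_sum_left (β : V →ₗ[k] W →ₗ[k] N) (A : FMat X V) (B : FMat X W)
    (i j : X) :
    FMat.mul β A B (i, j) = (Finsupp.curry A i).sum fun l a => β a (B (l, j)) := by
  rw [FMat.mul_apply, finsum_eq_sum_of_support_subset _ (s := (Finsupp.curry A i).support)]
  · rfl
  · intro l hl
    rw [Finset.mem_coe, Finsupp.mem_support_iff]
    intro h
    rw [Finsupp.curry_apply] at h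
    exact hl (by simp [h])

theorem FMat.mul_apply_eq_sum_right (β : V →ₗ[k] W →ₗ[k] N) (A : FMat X V) (B : FMat X W)
    (i j : X) :
    FMat.mul β A B (i, j) =
      (Finsupp.curry (B.equivMapDomain (Equiv.prodComm X X)) j).sum fun l b => β (A (i, l)) b := by
  rw [FMat.mul_apply, finsum_eq_sum_of_support_subset _
    (s := (Finsupp.curry (B.equivMapDomain (Equiv.prodComm X X)) j).support)]
  · rfl
  · intro l hl
    rw [Finset.mem_coe, Finsupp.mem_support_iff]
    intro h
    have h : B (l, j) = 0 := h
    exact hl (by simp [h])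

variable (k X) in
/-- A matrix as its finitely supported family of rows. -/
def FMat.rows (V : Type*) [AddCommGroup V] [Module k V] : FMat X V ≃ₗ[k] (X →₀ X →₀ V) :=
  Finsupp.curryLinearEquiv k

variable (k X) in
/-- A matrix as its finitely supported family of columns. -/
def FMat.cols (V : Type*) [AddCommGroup V] [Module k V] : FMat X V ≃ₗ[k] (X →₀ X →₀ V) :=
  (Finsupp.domLCongr (Equiv.prodComm X X)).trans (Finsupp.curryLinearEquiv k)

@[simp]
theorem FMat.rows_apply (A : FMat X V) (i j : X) : FMat.rows k X V A i j = A (i, j) := rfl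

@[simp]
theorem FMat.cols_apply (A : FMat X V) (i j : X) : FMat.cols k X V A j i = A (i, j) := rfl

/-- Left multiplication by `A` forms combinations of the rows of `B` with coefficients from `A`, so
an equivariant map applied row by row commutes with it. -/
theorem FMat.mul_apply_eq_sum_rows (β : V →ₗ[k] W →ₗ[k] N) (A : FMat X V) (B : FMat X W) (i : X) :
    FMat.rows k X N (FMat.mul β A B) i = (FMat.rows k X V A i).sum fun l a =>
      Finsupp.mapRange.linearMap (β a) (FMat.rows k X W B l) := by
  ext j
  rw [FMat.rows_apply, FMat.mul_apply_eq_sum_left, Finsupp.sum_apply]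
  rfl

theorem FMat.mul_apply_eq_sum_cols (β : V →ₗ[k] W →ₗ[k] N) (A : FMat X V) (B : FMat X W) (j : X) :
    FMat.cols k X N (FMat.mul β A B) j = (FMat.cols k X W B j).sum fun l b =>
      Finsupp.mapRange.linearMap (β.flip b) (FMat.cols k X V A l) := by
  ext i
  rw [FMat.cols_apply, FMat.mul_apply_eq_sum_right, Finsupp.sum_apply]
  rfl

theorem DualPair.mul_pairing_apply {R S : Type*} (D : DualPair k R S N V W) (A : FMat X V)
    (B : FMat X W) (i j : X) : FMat.mul D.pairing A B (i, j) =
      (D.sum X).pairing (FMat.rows k X V A i) (FMat.cols k X W B j) := by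
  rw [FMat.mul_apply_eq_sum_left, DualPair.sum_pairing_apply]
  rfl

/-- Apply a linear equivalence to the rows of matrices. -/
def FMat.rowsCongr (φ : (X →₀ V) ≃ₗ[k] (X →₀ W)) : FMat X V ≃ₗ[k] FMat X W :=
  ((FMat.rows k X V).trans (Finsupp.mapRange.linearEquiv φ)).trans (FMat.rows k X W).symm

/-- Apply a linear equivalence to the columns of matrices. -/
def FMat.colsCongr (φ : (X →₀ V) ≃ₗ[k] (X →₀ W)) : FMat X V ≃ₗ[k] FMat X W :=
  ((FMat.cols k X V).trans (Finsupp.mapRange.linearEquiv φ)).trans (FMat.cols k X W).symm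

@[simp]
theorem FMat.rows_rowsCongr (φ : (X →₀ V) ≃ₗ[k] (X →₀ W)) (A : FMat X V) (i : X) :
    FMat.rows k X W (FMat.rowsCongr φ A) i = φ (FMat.rows k X V A i) := by
  simp [FMat.rowsCongr]

@[simp]
theorem FMat.cols_colsCongr (φ : (X →₀ V) ≃ₗ[k] (X →₀ W)) (A : FMat X V) (j : X) :
    FMat.cols k X W (FMat.colsCongr φ A) j = φ (FMat.cols k X V A j) := by
  simp [FMat.colsCongr]

end Matrices

end StableMorita

end

/-! ### The main theorem -/

theorem theorem7p1 {k R R' M M' X : Type*} [CommRing k]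
    [NonUnitalRing R] [Module k R] [IsScalarTower k R R] [SMulCommClass k R R]
    [NonUnitalRing R'] [Module k R'] [IsScalarTower k R' R'] [SMulCommClass k R' R']
    [AddCommGroup M] [Module k M] [AddCommGroup M'] [Module k M']
    (E : Set R) (hE : StableMorita.IsOrthogonalLocalUnits k E)
    (F : Set R') (hF : StableMorita.IsOrthogonalLocalUnits k F)
    [Infinite X]
    (hEX : Nonempty (E ↪ X))
    (hFX : Nonempty (F ↪ X))
    (C : StableMorita.MoritaContext k R R' M M')
    (hM : C.bimod.IsUnital) (hM' : C.bimod'.IsUnital)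
    (hτ : Function.Surjective C.τ) (hτ' : Function.Surjective C.τ') :
    ∃ (Ψ : StableMorita.FMat X R ≃ₗ[k] StableMorita.FMat X M)
      (Ψ' : StableMorita.FMat X R' ≃ₗ[k] StableMorita.FMat X M),
      (∀ A B : StableMorita.FMat X R,
        Ψ (StableMorita.FMat.mul (LinearMap.mul k R) A B) =
          StableMorita.FMat.mul C.bimod.left A (Ψ B)) ∧
      (∀ A' B' : StableMorita.FMat X R',
        Ψ' (StableMorita.FMat.mul (LinearMap.mul k R') A' B') =
          StableMorita.FMat.mul C.bimod.right (Ψ' A') B') ∧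
      (∀ (A : StableMorita.FMat X R) (A' : StableMorita.FMat X R'),
        StableMorita.FMat.mul C.bimod.right (Ψ A) A' =
          StableMorita.FMat.mul C.bimod.left A (Ψ' A')) := by
  open StableMorita in
  obtain ⟨n, ⟨f⟩⟩ := C.nonempty_retract_leftPair hE hM hτ
  obtain ⟨n', ⟨f'⟩⟩ := C.nonempty_retract_rightPair hF hM hτ'
  obtain ⟨φ⟩ := DualPair.nonempty_iso_sum (X := X) f f'
    (nonempty_prod_sigma_fin_embedding hEX n) (nonempty_prod_sigma_fin_embedding hFX n')
  refine ⟨FMat.rowsCongr φ.toV, FMat.colsCongr φ.toW, fun A B => ?_, fun A B => ?_, fun A B => ?_⟩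
  · refine (FMat.rows k X M).injective (Finsupp.ext fun i => ?_)
    simp only [FMat.rows_rowsCongr, FMat.mul_apply_eq_sum_rows, map_finsuppSum]
    exact Finsupp.sum_congr fun l _ => φ.map_left _ _
  · refine (FMat.cols k X M).injective (Finsupp.ext fun j => ?_)
    simp only [FMat.cols_colsCongr, FMat.mul_apply_eq_sum_cols, map_finsuppSum]
    exact Finsupp.sum_congr fun l _ => φ.map_right _ _
  · refine Finsupp.ext fun ⟨i, j⟩ => ?_
    -- Entry `(i, j)` of either product pairs row `i` with column `j`, so the identity is
    -- adjointness of `φ` entry by entry.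
    have h := φ.adj (FMat.rows k X R A i) (FMat.cols k X R' B j)
    rw [← FMat.rows_rowsCongr, ← FMat.cols_colsCongr, ← DualPair.mul_pairing_apply,
      ← DualPair.mul_pairing_apply] at h
    exact h
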